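/- For a positive integer $n$ let $C_n$ be the cycle graph on $n$ vertices, and for $d \ge 1$ let the toroidal grid graph $T^d_n = (C_n)^d$ be the $d$-fold Cartesian (box) product of $C_n$ with itself: its vertices are the $d$-tuples of vertices of $C_n$, and two of them are adjacent if and only if they are adjacent in $C_n$ in exactly one coordinate and agree in all other coordinates. (For $d=2$ this is the $n\times n$ toroidal grid graph.) Call a sequence $(p_k)_{k\ge 0}$ of polynomials with rational coefficients of \emph{binomial type} if $p_0 = 1$, $p_k(0)=0$ for all $k>0$, and for every integer $m\ge 0$ the identity of formal power series $$\Bigl(\sum_{k\ge 0} p_k(1)\,x^k\Bigr)^m=\sum_{k\ge 0} p_k(m)\,x^k$$ holds. Theorem. Fix an integer $d\ge 1$. Let $\chi_n(x)$ be the chromatic polynomial of $T^d_n$, that is, the polynomial whose value at each integer $q \ge 0$ is the number of proper colourings of the vertices of $T^d_n$ with $q$ colours. Then there is a sequence $(p_k)_{k\ge 0}$ of polynomials with rational coefficients, of binomial type, such that for every $k\ge 0$ there is an $n_0=n_0(k)$ such that for all $n\ge n_0$ the coefficient of $x^{n^d-k}$ in $\chi_n(x)$, multiplied by $(-1)^k$,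 equals $p_k(n^d)$. -/

import Mathlib

open Polynomial Filter

namespace ToroidalGrid

/-- The `d`-fold Cartesian (box) power `G × ⋯ × G` of a graph: two vertices are adjacent iff they
are adjacent in `G` in one coordinate and equal in all the others. -/
def boxPow {V : Type*} (G : SimpleGraph V) (d : ℕ) : SimpleGraph (Fin d → V) where
  Adj x y := ∃ i, G.Adj (x i) (y i) ∧ ∀ j, j ≠ i → x j = y j
  symm := ⟨fun _ _ ⟨i, h, h'⟩ => ⟨i, h.symm, fun j hj => (h' j hj).symm⟩⟩
  loopless := ⟨fun _ ⟨_, h, _⟩ => h.ne rfl⟩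

/-- The `d`-dimensional toroidal grid graph of size `n`: the `d`-th power of the cycle graph on
`n` vertices. -/
def torusGraph (d n : ℕ) : SimpleGraph (Fin d → Fin n) :=
  boxPow (SimpleGraph.cycleGraph n) d

/-- Vertex maps that are constant along all edges of a graph are maps from its set of connected
components. -/
def constMapEquiv {V C : Type*} (G : SimpleGraph V) :
    {c : V → C // ∀ u v, G.Adj u v → c u = c v} ≃ (G.ConnectedComponent → C) where
  toFun c := fun K => K.lift c.1 (fun v w p hp => by
    clear hp
    induction p with
    | nil => rfl
    | cons h p ih => exact (c.2 _ _ h).trans ih)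
  invFun f := ⟨fun v => f (G.connectedComponentMk v), fun u v h => by
    exact congrArg f (SimpleGraph.ConnectedComponent.sound h.reachable)⟩
  left_inv c := by ext v; rfl
  right_inv f := by
    funext K
    induction K using SimpleGraph.ConnectedComponent.ind with
    | h v => rfl

/-- The number of proper colourings with `q` colours is a polynomial function of `q`. -/
theorem exists_chromaticPolynomial {V : Type*} [Finite V] (G : SimpleGraph V) :
    ∃ P : ℤ[X], ∀ q : ℕ, P.eval (q : ℤ) = (Nat.card (G.Coloring (Fin q)) : ℤ) := by
  classical
  have := Fintype.ofFinite V
  refine ⟨∑ A ∈ G.edgeFinset.powerset, (-1) ^ A.card *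
    X ^ Nat.card (SimpleGraph.fromEdgeSet (A : Set (Sym2 V))).ConnectedComponent, fun q => ?_⟩
  let mono : (V → Fin q) → Sym2 V → Prop := fun c e => (e.map c).IsDiag
  have h1 : Nat.card (G.Coloring (Fin q)) =
      Nat.card {c : V → Fin q // ∀ e ∈ G.edgeFinset, ¬ mono c e} := by
    refine Nat.card_congr ⟨fun c => ⟨c, ?_⟩, fun c => SimpleGraph.Coloring.mk c.1 ?_, ?_, ?_⟩
    · intro e
      induction e using Sym2.ind with
      | h u v => simpa [mono] using fun h => c.valid h
    · intro u v h
      have := c.2 s(u, v) (by simpa using h)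
      simpa [mono] using this
    · intro c; rfl
    · intro c; rfl
  have h2 : ∀ A ∈ G.edgeFinset.powerset,
      (Nat.card {c : V → Fin q // ∀ e ∈ A, mono c e}) = q ^
        Nat.card (SimpleGraph.fromEdgeSet (A : Set (Sym2 V))).ConnectedComponent := by
    intro A hA
    have e : {c : V → Fin q // ∀ e ∈ A, mono c e} ≃ {c : V → Fin q //
        ∀ u v, (SimpleGraph.fromEdgeSet (A : Set (Sym2 V))).Adj u v → c u = c v} := by
      refine Equiv.subtypeEquivRight fun c => ?_
      constructor
      · intro h u v huv
        simp only [SimpleGraph.fromEdgeSet_adj] at huv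
        simpa [mono] using h s(u, v) (by exact_mod_cast huv.1)
      · intro h e he
        induction e using Sym2.ind with
        | h u v =>
          by_cases huv : u = v
          · simp [mono, huv]
          · simpa [mono] using h u v (by simp [huv, he])
    rw [Nat.card_congr (e.trans (constMapEquiv _)), Nat.card_fun]
    simp
  have h3 : (Nat.card {c : V → Fin q // ∀ e ∈ G.edgeFinset, ¬ mono c e} : ℤ) =
      ∑ c : V → Fin q, ∏ e ∈ G.edgeFinset, (1 + -(if mono c e then (1 : ℤ) else 0)) := by
    rw [Nat.card_eq_fintype_card, Fintype.card_subtype, Finset.card_filter]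
    push_cast
    refine Finset.sum_congr rfl fun c _ => ?_
    split_ifs with h
    · rw [Finset.prod_eq_one]
      intro e he
      simp [h e he]
    · push Not at h
      obtain ⟨e, he, hm⟩ := h
      rw [Finset.prod_eq_zero he]
      simp [hm]
  rw [h1, h3]
  simp_rw [Finset.prod_one_add]
  rw [Finset.sum_comm, eval_finsetSum]
  refine Finset.sum_congr rfl fun A hA => ?_
  have h4 := h2 A hA
  rw [Nat.card_eq_fintype_card, Fintype.card_subtype, Finset.card_filter] at h4
  have h5 : ∀ c : V → Fin q, ∏ e ∈ A, -(if mono c e then (1 : ℤ) else 0) =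
      (-1) ^ A.card * ((if ∀ e ∈ A, mono c e then 1 else 0 : ℕ) : ℤ) := by
    intro c
    rw [Finset.prod_neg, Finset.prod_ite_zero]
    simp
  simp_rw [h5]
  rw [← Finset.mul_sum, ← Nat.cast_sum, h4]
  simp

/-- The chromatic polynomial of a finite graph: the polynomial whose value at each natural number
`q` is the number of proper colourings of the graph with `q` colours. -/
noncomputable def chromaticPolynomial {V : Type*} [Finite V] (G : SimpleGraph V) : ℤ[X] :=
  (exists_chromaticPolynomial G).choose

theorem chromaticPolynomial_eval {V : Type*} [Finite V] (G : SimpleGraph V) (q : ℕ) :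
    (chromaticPolynomial G).eval (q : ℤ) = (Nat.card (G.Coloring (Fin q)) : ℤ) :=
  (exists_chromaticPolynomial G).choose_spec q

/-- The chromatic polynomial is the only polynomial that counts proper colourings. -/
theorem eq_chromaticPolynomial {V : Type*} [Finite V] (G : SimpleGraph V) (P : ℤ[X])
    (hP : ∀ q : ℕ, P.eval (q : ℤ) = (Nat.card (G.Coloring (Fin q)) : ℤ)) :
    P = chromaticPolynomial G := by
  refine Polynomial.eq_of_infinite_eval_eq _ _ ?_
  refine (Set.infinite_range_of_injective (Nat.cast_injective (R := ℤ))).mono ?_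
  rintro _ ⟨q, rfl⟩
  exact (hP q).trans (chromaticPolynomial_eval G q).symm

/-- A sequence of polynomials is of binomial type if `p 0 = 1`, `p i` vanishes at `0` for `i > 0`,
and `(∑ i, p i (1) x ^ i) ^ n = ∑ i, p i (n) x ^ i` as formal power series for every natural
number `n`. -/
structure IsBinomialType (p : ℕ → ℚ[X]) : Prop where
  zero : p 0 = 1
  eval_zero : ∀ i, 0 < i → (p i).eval 0 = 0
  pow_eq : ∀ n : ℕ, (PowerSeries.mk fun i => (p i).eval 1) ^ n =
    PowerSeries.mk fun i => (p i).eval (n : ℚ)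

end ToroidalGrid

/-! This is a cluster expansion. For a set `S` of vertices let `Z_S` be the reversed, signed
chromatic polynomial of the graph keeping only the edges inside `S`. It is multiplicative over
disjoint sets with no edge between them, so its logarithmic derivative is additive. Hence the Möbius
transform of each coefficient of the latter, `ursell`, vanishes on disconnected sets
(`ursell_union_eq_zero`).

It also vanishes on large sets. In the alternating sum over subsets of `U` only those colourings
survive in which every vertex of `U` has a neighbour in `U` of the same colour. They use at most
`|U|/2` colours on `U`, so the degree drops by at least `|U|/2` (`natDegree_alternating_sum_le`).
Thus the `k`-th coefficient of `Z` only sees sets of at most `2k` vertices, and that of the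
logarithmic derivative sets of at most `2(k+1)` (`hasDegree_coeff_logDerivative`).

The `k`-th coefficient is therefore a sum over small connected sets. In a large torus these look
like sets in a box, and all vertices are equivalent, so the sum is `n^d` times a constant
independent of `n` (`coeff_logDerivative_torusGraph`). A series with constant term `1` and
logarithmic derivative `y * c` is the `y`-th power of a fixed series. Its coefficients are
polynomials in `y` of binomial type, taken here at `y = n^d`. -/

namespace ToroidalGrid

/-! ### Möbius inversion over finite sets -/

section Moebius

variable {V : Type*}

/-- The Möbius transform of a function of finite sets. -/
def moebius (f : Finset V → ℚ) (U : Finset V) : ℚ :=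
  ∑ S ∈ U.powerset, (-1) ^ (U.card + S.card) * f S

theorem moebius_congr {f g : Finset V → ℚ} {U : Finset V} (h : ∀ S ⊆ U, f S = g S) :
    moebius f U = moebius g U :=
  Finset.sum_congr rfl fun S hS => by rw [h S (Finset.mem_powerset.1 hS)]

theorem moebius_sub (f g : Finset V → ℚ) (U : Finset V) :
    moebius (fun S => f S - g S) U = moebius f U - moebius g U := by
  simp only [moebius, mul_sub, Finset.sum_sub_distrib]

theorem moebius_const_mul (a : ℚ) (f : Finset V → ℚ) (U : Finset V) :
    moebius (fun S => a * f S) U = a * moebius f U := by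
  simp only [moebius, Finset.mul_sum]
  exact Finset.sum_congr rfl fun S _ => by ring

theorem moebius_sum {ι : Type*} (s : Finset ι) (f : ι → Finset V → ℚ) (U : Finset V) :
    moebius (fun S => ∑ i ∈ s, f i S) U = ∑ i ∈ s, moebius (f i) U := by
  simp only [moebius, Finset.mul_sum]
  exact Finset.sum_comm

/-- The transform is an iterated difference, one difference operator for each element. -/
theorem moebius_insert [DecidableEq V] (f : Finset V → ℚ) {a : V} {U : Finset V} (ha : a ∉ U) :
    moebius f (insert a U) = moebius (fun S => f (insert a S)) U - moebius f U := by
  unfold moebius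
  rw [Finset.sum_powerset_insert ha, Finset.card_insert_of_notMem ha, add_comm, sub_eq_add_neg,
    ← Finset.sum_neg_distrib]
  congr 1 <;> refine Finset.sum_congr rfl fun S hS => ?_
  · rw [Finset.card_insert_of_notMem fun h => ha (Finset.mem_powerset.1 hS h)]
    ring
  · ring

/-- The transform vanishes at sets with an element that the function does not see. -/
theorem moebius_eq_zero [DecidableEq V] {f : Finset V → ℚ} {a : V} {U : Finset V} (ha : a ∈ U)
    (h : ∀ S ⊆ U, f (insert a S) = f S) : moebius f U = 0 := by
  rw [← Finset.insert_erase ha, moebius_insert _ (Finset.notMem_erase a U), sub_eq_zero]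
  exact moebius_congr fun S hS => h S (hS.trans (Finset.erase_subset _ _))

theorem sum_moebius (f : Finset V → ℚ) (S : Finset V) :
    ∑ U ∈ S.powerset, moebius f U = f S := by
  classical
  induction S using Finset.induction_on generalizing f with
  | empty => simp [moebius]
  | insert a S ha ih =>
    rw [Finset.sum_powerset_insert ha, ← Finset.sum_add_distrib, ← ih fun S => f (insert a S)]
    refine Finset.sum_congr rfl fun U hU => ?_
    rw [moebius_insert f fun h => ha (Finset.mem_powerset.1 hU h)]
    ring

theorem moebius_map {W : Type*} (e : V ↪ W) (f : Finset V → ℚ) (g : Finset W → ℚ)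
    (h : ∀ S, g (S.map e) = f S) (U : Finset V) : moebius g (U.map e) = moebius f U := by
  classical
  unfold moebius
  symm
  refine Finset.sum_bij (fun S _ => S.map e) ?_ ?_ ?_ ?_
  · intro S hS
    simpa using hS
  · intro S _ T _ hST
    exact Finset.map_injective e hST
  · intro T hT
    obtain ⟨S, hS, rfl⟩ := Finset.subset_map_iff.1 (Finset.mem_powerset.1 hT)
    exact ⟨S, by simpa using hS, rfl⟩
  · intro S _
    simp [h]

/-- The transform of a function vanishes at a disjoint union on which the function is additive. -/
theorem moebius_union_eq_zero [DecidableEq V] {f : Finset V → ℚ} {A B : Finset V}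
    (hA : A.Nonempty) (hB : B.Nonempty) (hAB : Disjoint A B)
    (hf : ∀ S ⊆ A ∪ B, f S = f (S ∩ A) + f (S ∩ B)) : moebius f (A ∪ B) = 0 := by
  obtain ⟨a, ha⟩ := hA
  obtain ⟨b, hb⟩ := hB
  have h1 : moebius (fun S => f (S ∩ A)) (A ∪ B) = 0 :=
    moebius_eq_zero (Finset.mem_union_right A hb) fun S _ => by
      rw [Finset.insert_inter_of_notMem fun h => Finset.disjoint_left.1 hAB h hb]
  have h2 : moebius (fun S => f (S ∩ B)) (A ∪ B) = 0 :=
    moebius_eq_zero (Finset.mem_union_left B ha) fun S _ => by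
      rw [Finset.insert_inter_of_notMem fun h => Finset.disjoint_left.1 hAB ha h]
  have h3 := moebius_sub f (fun S => f (S ∩ A)) (A ∪ B)
  rw [h1, sub_zero] at h3
  rw [← h3, ← h2]
  exact moebius_congr fun S hS => by rw [hf S hS]; ring

/-- A function of finite sets has degree at most `r` if its transform is supported on sets of at
most `r` elements. -/
def HasDegree (f : Finset V → ℚ) (r : ℕ) : Prop :=
  ∀ U : Finset V, r < U.card → moebius f U = 0

theorem HasDegree.mono {f : Finset V → ℚ} {r s : ℕ} (hf : HasDegree f r) (h : r ≤ s) :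
    HasDegree f s := fun U hU => hf U (h.trans_lt hU)

/-- Both factors are combinations of indicators of `W ⊆ S`. The indicators for `W` and `W'` multiply
to that for `W ∪ W'`, whose transform vanishes at any set with an element outside `W ∪ W'`. -/
theorem HasDegree.mul {f g : Finset V → ℚ} {r s : ℕ} (hf : HasDegree f r) (hg : HasDegree g s) :
    HasDegree (fun S => f S * g S) (r + s) := by
  classical
  intro U hU
  have expand : ∀ (f : Finset V → ℚ), ∀ S ⊆ U,
      f S = ∑ W ∈ U.powerset, moebius f W * if W ⊆ S then 1 else 0 := by
    intro f S hS
    conv_lhs => rw [← sum_moebius f S]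
    simp only [mul_ite, mul_one, mul_zero, ← Finset.sum_filter]
    refine Finset.sum_congr ?_ fun _ _ => rfl
    ext W
    simp only [Finset.mem_powerset, Finset.mem_filter]
    exact ⟨fun h => ⟨h.trans hS, h⟩, fun h => h.2⟩
  have key : moebius (fun S => f S * g S) U = moebius (fun S => ∑ W ∈ U.powerset,
      ∑ W' ∈ U.powerset, (moebius f W * moebius g W') * if W ∪ W' ⊆ S then 1 else 0) U := by
    refine moebius_congr fun S hS => ?_
    rw [expand f S hS, expand g S hS, Finset.sum_mul_sum]
    refine Finset.sum_congr rfl fun W _ => Finset.sum_congr rfl fun W' _ => ?_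
    simp only [Finset.union_subset_iff]
    split_ifs <;> simp_all
  rw [key, moebius_sum]
  refine Finset.sum_eq_zero fun W hW => ?_
  rw [moebius_sum]
  refine Finset.sum_eq_zero fun W' hW' => ?_
  rw [moebius_const_mul]
  by_cases h1 : r < W.card
  · simp [hf W h1]
  by_cases h2 : s < W'.card
  · simp [hg W' h2]
  obtain ⟨a, haU, ha⟩ : ∃ a ∈ U, a ∉ W ∪ W' := by
    by_contra! h
    have := (Finset.card_le_card h).trans (Finset.card_union_le W W')
    omega
  rw [moebius_eq_zero haU, mul_zero]
  intro S _
  simp only [Finset.subset_insert_iff_of_notMem ha]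

end Moebius
/-! ### Polynomials determined or bounded by their values -/

theorem polynomial_ext_nat {P Q : ℤ[X]} (h : ∀ q : ℕ, P.eval (q : ℤ) = Q.eval (q : ℤ)) : P = Q := by
  refine Polynomial.eq_of_infinite_eval_eq _ _ ?_
  refine (Set.infinite_range_of_injective (Nat.cast_injective (R := ℤ))).mono ?_
  rintro _ ⟨q, rfl⟩
  exact h q

theorem natDegree_le_of_abs_eval_le {P : ℤ[X]} {C m : ℕ}
    (h : ∀ q : ℕ, 0 < q → |P.eval (q : ℤ)| ≤ C * q ^ m) : P.natDegree ≤ m := by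
  by_contra! hm
  have hdeg : ((Polynomial.C (C : ℤ)) * X ^ m : ℤ[X]).degree < P.degree :=
    degree_lt_degree ((natDegree_C_mul_X_pow_le _ _).trans_lt hm)
  refine Set.Infinite.not_finite ?_ (finite_abs_eval_le_of_degree_lt hdeg)
  refine (Set.infinite_range_of_injective (f := fun q : ℕ => ((q + 1 : ℕ) : ℤ)) ?_).mono ?_
  · intro a b hab
    simpa using hab
  · rintro _ ⟨q, rfl⟩
    have := h (q + 1) q.succ_pos
    simp only [Set.mem_ofPred_eq, eval_mul, eval_C, eval_pow, eval_X]
    rwa [abs_of_nonneg (a := (C : ℤ) * _) (by positivity)]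

/-! ### Colourings that are proper on a set of vertices -/

section Proper

variable {V W : Type*}

/-- The graph of all edges with both ends in a given set of vertices. -/
def within (G : SimpleGraph V) (S : Finset V) : SimpleGraph V where
  Adj u v := G.Adj u v ∧ u ∈ S ∧ v ∈ S
  symm := ⟨fun _ _ h => ⟨h.1.symm, h.2.2, h.2.1⟩⟩
  loopless := ⟨fun _ h => h.1.ne rfl⟩

theorem within_univ [Fintype V] (G : SimpleGraph V) : within G Finset.univ = G := by
  ext u v
  simp [within]

/-- A vertex map is proper on a set of vertices if it separates adjacent vertices of the set. -/
def ProperOn (G : SimpleGraph V) {C : Type*} (S : Finset V) (c : V → C) : Prop :=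
  ∀ u ∈ S, ∀ v ∈ S, G.Adj u v → c u ≠ c v

theorem chromaticPolynomial_within_eval [Finite V] (G : SimpleGraph V) (S : Finset V) (q : ℕ) :
    (chromaticPolynomial (within G S)).eval (q : ℤ) =
      (Nat.card {c : V → Fin q // ProperOn G S c} : ℤ) := by
  rw [chromaticPolynomial_eval]
  congr 1
  refine Nat.card_congr ⟨fun c => ⟨c, fun u hu v hv h => c.valid ⟨h, hu, hv⟩⟩,
    fun c => SimpleGraph.Coloring.mk c.1 fun {u v} h => c.2 u h.2.1 v h.2.2 h.1, ?_, ?_⟩ <;>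
  · intro c; rfl

theorem properOn_union_iff [DecidableEq V] {G : SimpleGraph V} {C : Type*} {S T : Finset V}
    (hadj : ∀ u ∈ S, ∀ v ∈ T, ¬ G.Adj u v) (c : V → C) :
    ProperOn G (S ∪ T) c ↔ ProperOn G S c ∧ ProperOn G T c := by
  refine ⟨fun h => ⟨fun u hu v hv => h u (Finset.mem_union_left _ hu) v (Finset.mem_union_left _ hv),
    fun u hu v hv => h u (Finset.mem_union_right _ hu) v (Finset.mem_union_right _ hv)⟩, ?_⟩
  rintro ⟨h1, h2⟩ u hu v hv h
  rcases Finset.mem_union.1 hu with hu | hu <;> rcases Finset.mem_union.1 hv with hv | hv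
  · exact h1 u hu v hv h
  · exact absurd h (hadj u hu v hv)
  · exact absurd h.symm (hadj v hv u hu)
  · exact h2 u hu v hv h

theorem properOn_congr {G : SimpleGraph V} {C : Type*} {S : Finset V} {c e : V → C}
    (h : ∀ v ∈ S, c v = e v) : ProperOn G S c ↔ ProperOn G S e :=
  forall₂_congr fun u hu => forall₂_congr fun v hv => by rw [h u hu, h v hv]

theorem chromaticPolynomial_within_union [Fintype V] [DecidableEq V] (G : SimpleGraph V)
    {S T : Finset V} (hST : Disjoint S T) (hadj : ∀ u ∈ S, ∀ v ∈ T, ¬ G.Adj u v) :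
    chromaticPolynomial (within G (S ∪ T)) * X ^ Fintype.card V =
      chromaticPolynomial (within G S) * chromaticPolynomial (within G T) := by
  refine polynomial_ext_nat fun q => ?_
  simp only [eval_mul, eval_pow, eval_X, chromaticPolynomial_within_eval]
  have h1 : (q : ℤ) ^ Fintype.card V = (Nat.card (V → Fin q) : ℤ) := by simp
  rw [h1]
  norm_cast
  rw [← Nat.card_prod, ← Nat.card_prod]
  -- The factor `X ^ card V` counts a second, unrestricted colouring. Exchanging the two colourings
  -- outside `S` moves the condition on `T` to the second one.
  let σ : (V → Fin q) × (V → Fin q) → (V → Fin q) × (V → Fin q) := fun p =>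
    (S.piecewise p.1 p.2, S.piecewise p.2 p.1)
  have hσ : Function.Involutive σ := by
    rintro ⟨c, e⟩
    ext v <;> by_cases hv : v ∈ S <;> simp [σ, hv]
  have key : ∀ p : (V → Fin q) × (V → Fin q), ProperOn G (S ∪ T) p.1 ↔
      ProperOn G S (σ p).1 ∧ ProperOn G T (σ p).2 := by
    intro p
    rw [properOn_union_iff hadj]
    refine and_congr (properOn_congr fun v hv => ?_) (properOn_congr fun v hv => ?_)
    · simp [σ, hv]
    · simp [σ, Finset.disjoint_right.1 hST hv]
  have e1 : {c : V → Fin q // ProperOn G (S ∪ T) c} × (V → Fin q) ≃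
      {p : (V → Fin q) × (V → Fin q) // ProperOn G (S ∪ T) p.1} :=
    ⟨fun p => ⟨(p.1.1, p.2), p.1.2⟩, fun p => (⟨p.1.1, p.2⟩, p.1.2), fun _ => rfl, fun _ => rfl⟩
  refine Nat.card_congr (e1.trans ((hσ.toPerm.subtypeEquiv key).trans
    (Equiv.subtypeProdEquivProd (p := ProperOn G S) (q := ProperOn G T))))

/-- Vertices outside the range of `f` are isolated and coloured freely. -/
theorem chromaticPolynomial_within_map [Fintype V] [Fintype W] {G : SimpleGraph V}
    {H : SimpleGraph W} (f : G ↪g H) (S : Finset V) :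
    chromaticPolynomial (within H (S.map f.toEmbedding)) =
      chromaticPolynomial (within G S) * X ^ (Fintype.card W - Fintype.card V) := by
  classical
  refine polynomial_ext_nat fun q => ?_
  simp only [eval_mul, eval_pow, eval_X, chromaticPolynomial_within_eval]
  let R : Set W := Set.range f
  have h1 : (q : ℤ) ^ (Fintype.card W - Fintype.card V) = (Nat.card ((Rᶜ : Set W) → Fin q) : ℤ) := by
    have : Nat.card (Rᶜ : Set W) = Fintype.card W - Fintype.card V := by
      rw [Nat.card_eq_fintype_card, Fintype.card_compl_set, Set.card_range_of_injective f.injective]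
    rw [Nat.card_fun, this]
    simp
  rw [h1]
  norm_cast
  rw [← Nat.card_prod]
  let e : V ⊕ (Rᶜ : Set W) ≃ W :=
    ((Equiv.ofInjective f f.injective).sumCongr (Equiv.refl _)).trans (Equiv.Set.sumCompl R)
  have he : ∀ v, e (Sum.inl v) = f v := fun v => by simp [e, R]
  let E : (W → Fin q) ≃ (V → Fin q) × ((Rᶜ : Set W) → Fin q) :=
    (Equiv.arrowCongr e.symm (Equiv.refl _)).trans (Equiv.sumArrowEquivProdArrow _ _ _)
  have hE : ∀ c v, (E c).1 v = c (f v) := fun c v => by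
    rw [← he]; rfl
  have key : ∀ c : W → Fin q, ProperOn H (S.map f.toEmbedding) c ↔ ProperOn G S (E c).1 := by
    intro c
    simp only [ProperOn, hE, Finset.forall_mem_map]
    simp
  refine Nat.card_congr ((E.subtypeEquiv (q := fun p => ProperOn G S p.1) key).trans
    ⟨fun p => (⟨p.1.1, p.2⟩, p.1.2), fun p => ⟨(p.1.1, p.2), p.1.2⟩, fun _ => rfl, fun _ => rfl⟩)

theorem natDegree_chromaticPolynomial_le [Fintype V] (G : SimpleGraph V) :
    (chromaticPolynomial G).natDegree ≤ Fintype.card V := by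
  refine natDegree_le_of_abs_eval_le (C := 1) fun q _ => ?_
  rw [← within_univ G, chromaticPolynomial_within_eval, Nat.abs_cast]
  have := Nat.card_le_card_of_injective _
    (Subtype.val_injective (p := fun c : V → Fin q => ProperOn G Finset.univ c))
  rw [Nat.card_fun, Nat.card_fin, Nat.card_eq_fintype_card (α := V)] at this
  rw [Nat.cast_one, one_mul]
  exact_mod_cast this

/-- Few maps have a small range. -/
theorem card_filter_card_image_le [Fintype V] [DecidableEq V] (m q : ℕ) (hq : 0 < q) :
    (Finset.univ.filter fun c : V → Fin q => (Finset.univ.image c).card ≤ m).card ≤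
      m ^ Fintype.card V * q ^ m := by
  have : Nonempty (Fin q) := ⟨⟨0, hq⟩⟩
  have h : (Finset.univ.filter fun c : V → Fin q => (Finset.univ.image c).card ≤ m) ⊆
      Finset.univ.image fun p : (V → Fin m) × (Fin m → Fin q) => p.2 ∘ p.1 := by
    intro c hc
    rw [Finset.mem_filter] at hc
    -- A map with at most `m` values factors through `Fin m`.
    obtain ⟨e⟩ := Function.Embedding.nonempty_of_card_le
      (α := (Finset.univ.image c : Finset (Fin q))) (β := Fin m) (by
        rw [Fintype.card_coe, Fintype.card_fin]; exact hc.2)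
    rw [Finset.mem_image]
    refine ⟨(fun v => e ⟨c v, Finset.mem_image_of_mem _ (Finset.mem_univ v)⟩,
      Function.extend e Subtype.val fun _ => Classical.arbitrary _), Finset.mem_univ _, ?_⟩
    funext v
    simp [e.injective.extend_apply]
  refine (Finset.card_le_card h).trans (Finset.card_image_le.trans ?_)
  simp

/-- If a colouring is proper at some vertex of `U`, then the transform of its properness vanishes
at `U`. Otherwise it uses every colour of `U` twice. -/
theorem card_image_le_of_moebius_ne_zero [Fintype V] [DecidableEq V] {G : SimpleGraph V} {q : ℕ}
    {c : V → Fin q} {U : Finset V} [DecidablePred fun S => ProperOn G S c]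
    (h : moebius (fun S => if ProperOn G S c then 1 else 0) U ≠ 0) :
    (Finset.univ.image c).card ≤ Fintype.card V - U.card + U.card / 2 := by
  have h1 : ∀ u ∈ U, ∃ v ∈ U, G.Adj u v ∧ c u = c v := by
    intro u hu
    by_contra! hc
    refine h (moebius_eq_zero hu fun S hS => ?_)
    -- If `u` conflicts with no vertex of `U`, properness does not see `u`.
    have : ProperOn G (insert u S) c ↔ ProperOn G S c := by
      refine ⟨fun H a ha b hb => H a (Finset.mem_insert_of_mem ha) b (Finset.mem_insert_of_mem hb),
        fun H a ha b hb hab => ?_⟩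
      rcases Finset.mem_insert.1 ha with rfl | ha' <;>
        rcases Finset.mem_insert.1 hb with rfl | hb'
      · exact absurd rfl hab.ne
      · exact hc b (hS hb') hab
      · exact fun h => hc a (hS ha') hab.symm h.symm
      · exact H a ha' b hb' hab
    simp only [this]
  have h2 : 2 * (U.image c).card ≤ U.card := by
    refine Finset.mul_card_image_le_card _ _ fun a ha => ?_
    obtain ⟨u, hu, rfl⟩ := Finset.mem_image.1 ha
    obtain ⟨v, hv, huv, hc⟩ := h1 u hu
    exact Finset.one_lt_card.2 ⟨u, by simp [hu], v, by simp [hv, hc], huv.ne⟩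
  have h3 : (Finset.univ.image c).card ≤ (U.image c).card + (Uᶜ.image c).card := by
    rw [← Finset.union_compl U, Finset.image_union]
    exact Finset.card_union_le _ _
  have h4 := Finset.card_image_le (s := Uᶜ) (f := c)
  rw [Finset.card_compl] at h4
  omega

theorem abs_moebius_le {f : Finset V → ℚ} (hf : ∀ S, |f S| ≤ 1) (U : Finset V) :
    |moebius f U| ≤ 2 ^ U.card := by
  refine (Finset.abs_sum_le_sum_abs _ _).trans ?_
  refine (Finset.sum_le_card_nsmul _ _ 1 fun S _ => ?_).trans ?_
  · rw [abs_mul, abs_pow, abs_neg, abs_one, one_pow, one_mul]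
    exact hf S
  · simp

/-- The alternating sum of the chromatic polynomials of the subgraphs of a set has small degree. -/
theorem natDegree_alternating_sum_le [Fintype V] (G : SimpleGraph V) (U : Finset V) :
    (∑ S ∈ U.powerset, (-1) ^ (U.card + S.card) * chromaticPolynomial (within G S)).natDegree ≤
      Fintype.card V - U.card + U.card / 2 := by
  classical
  set m := Fintype.card V - U.card + U.card / 2 with hm
  -- At most `m ^ card V * q ^ m` colourings contribute, each at most `2 ^ U.card` in absolute
  -- value.
  refine natDegree_le_of_abs_eval_le (C := 2 ^ U.card * m ^ Fintype.card V) fun q hq => ?_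
  have h1 : (((∑ S ∈ U.powerset, (-1) ^ (U.card + S.card) *
      chromaticPolynomial (within G S)).eval (q : ℤ) : ℤ) : ℚ) =
      ∑ c : V → Fin q, moebius (fun S => if ProperOn G S c then 1 else 0) U := by
    rw [← moebius_sum]
    simp only [eval_finsetSum, eval_mul, eval_pow, eval_neg, eval_one,
      chromaticPolynomial_within_eval, moebius]
    push_cast
    refine Finset.sum_congr rfl fun S _ => ?_
    rw [Nat.card_eq_fintype_card, Fintype.card_subtype, Finset.card_filter]
    push_cast
    rfl
  rw [← Int.cast_le (R := ℚ), Int.cast_abs, h1]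
  refine (Finset.abs_sum_le_sum_abs _ _).trans ?_
  rw [← Finset.sum_filter_of_ne (p := fun c : V → Fin q => (Finset.univ.image c).card ≤ m)]
  · refine (Finset.sum_le_card_nsmul _ _ (2 ^ U.card) fun c _ => abs_moebius_le ?_ U).trans ?_
    · intro S
      split_ifs <;> simp
    · have := card_filter_card_image_le (V := V) m q hq
      rw [nsmul_eq_mul]
      push_cast
      rw [mul_assoc, mul_comm]
      refine mul_le_mul_of_nonneg_left ?_ (by positivity)
      exact_mod_cast this
  · intro c _ hc
    exact card_image_le_of_moebius_ne_zero fun h => hc (by rw [h, abs_zero])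

end Proper
/-! ### The reversed chromatic polynomial and its logarithmic derivative -/

section Series

variable {V W : Type*} [Fintype V] [Fintype W]

/-- The power series whose coefficient at `k` is `(-1) ^ k` times the coefficient of the chromatic
polynomial at `card V - k`. -/
noncomputable def chromaticSeries (G : SimpleGraph V) : PowerSeries ℚ :=
  PowerSeries.rescale (-1)
    (((reflect (Fintype.card V) (chromaticPolynomial G)).map (Int.castRingHom ℚ) : ℚ[X]) :
      PowerSeries ℚ)

theorem coeff_chromaticSeries (G : SimpleGraph V) (k : ℕ) :
    PowerSeries.coeff k (chromaticSeries G) =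
      (-1) ^ k * ((chromaticPolynomial G).coeff (revAt (Fintype.card V) k) : ℚ) := by
  simp [chromaticSeries, PowerSeries.coeff_rescale, coeff_reflect]

/-- Reversal cancels the powers of `X` that come from isolated vertices. -/
theorem reflect_mul_X_pow {P : ℤ[X]} {N : ℕ} (hP : P.natDegree ≤ N) (M : ℕ) :
    reflect (N + M) (P * X ^ M) = reflect N P := by
  rw [reflect_mul _ _ hP (natDegree_X_pow_le M), reflect_monomial]
  simp

theorem chromaticSeries_within_union [DecidableEq V] (G : SimpleGraph V)
    {S T : Finset V} (hST : Disjoint S T) (hadj : ∀ u ∈ S, ∀ v ∈ T, ¬ G.Adj u v) :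
    chromaticSeries (within G (S ∪ T)) =
      chromaticSeries (within G S) * chromaticSeries (within G T) := by
  unfold chromaticSeries
  rw [← map_mul, ← Polynomial.coe_mul, ← Polynomial.map_mul,
    ← reflect_mul _ _ (natDegree_chromaticPolynomial_le _) (natDegree_chromaticPolynomial_le _),
    ← chromaticPolynomial_within_union G hST hadj,
    reflect_mul_X_pow (natDegree_chromaticPolynomial_le _)]

theorem chromaticSeries_within_map {G : SimpleGraph V} {H : SimpleGraph W} (f : G ↪g H)
    (S : Finset V) :
    chromaticSeries (within H (S.map f.toEmbedding)) = chromaticSeries (within G S) := by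
  unfold chromaticSeries
  have h := Fintype.card_le_of_injective f f.injective
  rw [chromaticPolynomial_within_map f S, ← Nat.add_sub_cancel' h, Nat.add_sub_cancel_left,
    reflect_mul_X_pow (natDegree_chromaticPolynomial_le _)]

theorem hasDegree_coeff_chromaticSeries (G : SimpleGraph V) (k : ℕ) :
    HasDegree (fun S => PowerSeries.coeff k (chromaticSeries (within G S))) (2 * k) := by
  intro U hU
  have hUV := Finset.card_le_univ U
  simp only [coeff_chromaticSeries]
  rw [moebius_const_mul, revAt_le (by omega)]
  have h := coeff_eq_zero_of_natDegree_lt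
    ((natDegree_alternating_sum_le G U).trans_lt
      (by omega : Fintype.card V - U.card + U.card / 2 < Fintype.card V - k))
  have h' : moebius (fun S => ((chromaticPolynomial (within G S)).coeff (Fintype.card V - k) : ℚ))
      U = ((∑ S ∈ U.powerset, (-1) ^ (U.card + S.card) *
        chromaticPolynomial (within G S)).coeff (Fintype.card V - k) : ℤ) := by
    rw [finsetSum_coeff]
    push_cast
    refine Finset.sum_congr rfl fun S _ => ?_
    have : ((-1) ^ (U.card + S.card) : ℤ[X]) = Polynomial.C ((-1) ^ (U.card + S.card)) := by simp
    rw [this, coeff_C_mul]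
    push_cast
    rfl
  rw [h', h]
  simp

theorem chromaticPolynomial_within_empty (G : SimpleGraph V) :
    chromaticPolynomial (within G ∅) = X ^ Fintype.card V := by
  refine polynomial_ext_nat fun q => ?_
  rw [chromaticPolynomial_within_eval, Nat.card_congr (Equiv.subtypeUnivEquiv fun c => by
    simp [ProperOn]), Nat.card_fun]
  simp

theorem chromaticSeries_within_empty (G : SimpleGraph V) : chromaticSeries (within G ∅) = 1 := by
  simp [chromaticSeries, chromaticPolynomial_within_empty, reflect_monomial]

/-- In degree `0` only the empty set contributes. -/
theorem constantCoeff_chromaticSeries_within (G : SimpleGraph V) (S : Finset V) :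
    PowerSeries.constantCoeff (chromaticSeries (within G S)) = 1 := by
  have h0 := hasDegree_coeff_chromaticSeries G 0
  rw [← PowerSeries.coeff_zero_eq_constantCoeff_apply,
    ← sum_moebius (fun S => PowerSeries.coeff 0 (chromaticSeries (within G S))) S,
    Finset.sum_eq_single ∅]
  · simp [moebius, chromaticSeries_within_empty]
  · intro U _ hU
    exact h0 U (by simpa [Finset.card_pos] using Finset.nonempty_iff_ne_empty.2 hU)
  · simp

/-- The logarithmic derivative of a power series. -/
noncomputable def logDerivative (Z : PowerSeries ℚ) : PowerSeries ℚ :=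
  PowerSeries.derivative ℚ Z * Z⁻¹

theorem logDerivative_mul_self {Z : PowerSeries ℚ} (hZ : PowerSeries.constantCoeff Z ≠ 0) :
    logDerivative Z * Z = PowerSeries.derivative ℚ Z := by
  rw [logDerivative, mul_assoc, PowerSeries.inv_mul_cancel Z hZ, mul_one]

theorem logDerivative_mul {Y Z : PowerSeries ℚ} (hY : PowerSeries.constantCoeff Y ≠ 0)
    (hZ : PowerSeries.constantCoeff Z ≠ 0) :
    logDerivative (Y * Z) = logDerivative Y + logDerivative Z := by
  have hYZ : PowerSeries.constantCoeff (Y * Z) ≠ 0 := by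
    rw [map_mul]; exact mul_ne_zero hY hZ
  have h0 : Y * Z ≠ 0 := fun h => hYZ (by rw [h, map_zero])
  apply mul_right_cancel₀ h0
  rw [logDerivative_mul_self hYZ, Derivation.leibniz, ← logDerivative_mul_self hY,
    ← logDerivative_mul_self hZ, smul_eq_mul, smul_eq_mul]
  ring

theorem coeff_succ_eq_sum_logDerivative {Z : PowerSeries ℚ}
    (hZ : PowerSeries.constantCoeff Z ≠ 0) (k : ℕ) :
    PowerSeries.coeff (k + 1) Z * (k + 1) = ∑ i ∈ Finset.range (k + 1),
      PowerSeries.coeff i (logDerivative Z) * PowerSeries.coeff (k - i) Z := by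
  rw [← PowerSeries.coeff_derivative, ← logDerivative_mul_self hZ, PowerSeries.coeff_mul,
    Finset.Nat.sum_antidiagonal_eq_sum_range_succ_mk]

/-- Solve `Z' = L * Z` recursively for the coefficients of `L`. The degrees of the products match:
`2(i+1) + 2(k-i) = 2(k+1)`. -/
theorem hasDegree_coeff_logDerivative (G : SimpleGraph V) (k : ℕ) :
    HasDegree (fun S => PowerSeries.coeff k (logDerivative (chromaticSeries (within G S))))
      (2 * (k + 1)) := by
  induction k using Nat.strong_induction_on with
  | _ k ih =>
    have h1 : ∀ S, PowerSeries.coeff k (logDerivative (chromaticSeries (within G S))) =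
        (k + 1) * PowerSeries.coeff (k + 1) (chromaticSeries (within G S)) -
          ∑ i ∈ Finset.range k,
            PowerSeries.coeff i (logDerivative (chromaticSeries (within G S))) *
              PowerSeries.coeff (k - i) (chromaticSeries (within G S)) := by
      intro S
      have h := coeff_succ_eq_sum_logDerivative (Z := chromaticSeries (within G S))
        (by rw [constantCoeff_chromaticSeries_within]; exact one_ne_zero) k
      rw [Finset.sum_range_succ, Nat.sub_self, PowerSeries.coeff_zero_eq_constantCoeff_apply,
        constantCoeff_chromaticSeries_within] at h
      linarith
    intro U hU
    simp only [h1]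
    rw [moebius_sub, moebius_const_mul, moebius_sum,
      hasDegree_coeff_chromaticSeries G (k + 1) U hU, mul_zero, zero_sub, neg_eq_zero]
    refine Finset.sum_eq_zero fun i hi => ?_
    rw [Finset.mem_range] at hi
    exact (((ih i hi).mul (hasDegree_coeff_chromaticSeries G (k - i))).mono (by omega)) U hU

/-- The contribution of a set of vertices to a coefficient of the logarithmic derivative of the
chromatic series. -/
noncomputable def ursell (G : SimpleGraph V) (k : ℕ) (U : Finset V) : ℚ :=
  moebius (fun S => PowerSeries.coeff k (logDerivative (chromaticSeries (within G S)))) U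

theorem sum_ursell (G : SimpleGraph V) (k : ℕ) :
    ∑ U : Finset V, ursell G k U =
      PowerSeries.coeff k (logDerivative (chromaticSeries G)) := by
  rw [← Finset.powerset_univ]
  exact (sum_moebius _ _).trans (by rw [within_univ])

theorem ursell_map {G : SimpleGraph V} {H : SimpleGraph W} (f : G ↪g H) (k : ℕ) (U : Finset V) :
    ursell H k (U.map f.toEmbedding) = ursell G k U :=
  moebius_map f.toEmbedding _ _ (fun S => by rw [chromaticSeries_within_map f S]) U

theorem ursell_empty (G : SimpleGraph V) (k : ℕ) : ursell G k ∅ = 0 := by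
  simp [ursell, moebius, chromaticSeries_within_empty, logDerivative]

theorem card_le_of_ursell_ne_zero {G : SimpleGraph V} {k : ℕ} {U : Finset V}
    (h : ursell G k U ≠ 0) : U.card ≤ 2 * (k + 1) := by
  by_contra! hU
  exact h (hasDegree_coeff_logDerivative G k U hU)

theorem ursell_union_eq_zero [DecidableEq V] (G : SimpleGraph V) (k : ℕ) {A B : Finset V}
    (hA : A.Nonempty) (hB : B.Nonempty) (hAB : Disjoint A B)
    (hadj : ∀ u ∈ A, ∀ v ∈ B, ¬ G.Adj u v) : ursell G k (A ∪ B) = 0 := by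
  refine moebius_union_eq_zero hA hB hAB fun S hS => ?_
  have hZ : ∀ S, PowerSeries.constantCoeff (chromaticSeries (within G S)) ≠ 0 := fun S => by
    rw [constantCoeff_chromaticSeries_within]; exact one_ne_zero
  conv_lhs => rw [← Finset.inter_eq_left.2 hS, Finset.inter_union_distrib_left]
  rw [chromaticSeries_within_union G
    (hAB.mono Finset.inter_subset_right Finset.inter_subset_right)
    fun u hu v hv => hadj u (Finset.mem_inter.1 hu).2 v (Finset.mem_inter.1 hv).2,
    logDerivative_mul (hZ _) (hZ _), map_add]

/-- Two points of a set that contributes are joined by a walk in the set. -/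
theorem reachable_of_ursell_ne_zero {G : SimpleGraph V} {k : ℕ} {U : Finset V}
    (h : ursell G k U ≠ 0) (u v : (U : Set V)) : (G.induce (U : Set V)).Reachable u v := by
  classical
  by_contra huv
  -- Split `U` into the component of `u` and the rest; no edge joins them.
  let A := U.filter fun w => ∃ hw : w ∈ (U : Set V), (G.induce (U : Set V)).Reachable u ⟨w, hw⟩
  let B := U.filter fun w => ¬ ∃ hw : w ∈ (U : Set V), (G.induce (U : Set V)).Reachable u ⟨w, hw⟩
  have hAB : A ∪ B = U := Finset.filter_union_filter_not_eq _ U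
  rw [← hAB] at h
  refine h (ursell_union_eq_zero G k ⟨u, ?_⟩ ⟨v, ?_⟩ (Finset.disjoint_filter_filter_not _ _ _) ?_)
  · exact Finset.mem_filter.2 ⟨u.2, u.2, SimpleGraph.Reachable.refl _⟩
  · exact Finset.mem_filter.2 ⟨v.2, fun ⟨_, h⟩ => huv h⟩
  · intro a ha b hb hab
    obtain ⟨_, haU, hr⟩ := Finset.mem_filter.1 ha
    obtain ⟨hbU, hn⟩ := Finset.mem_filter.1 hb
    refine hn ⟨hbU, hr.trans (SimpleGraph.Adj.reachable ?_)⟩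
    exact hab

/-! ### Rooted contributions -/

/-- The contribution of a vertex to a coefficient of the logarithmic derivative of the chromatic
series, each set of vertices sharing its contribution equally among its elements. -/
noncomputable def rootedUrsell [DecidableEq V] (G : SimpleGraph V) (k : ℕ) (v : V) : ℚ :=
  ∑ U : Finset V with v ∈ U, ursell G k U / U.card

theorem sum_rootedUrsell [DecidableEq V] (G : SimpleGraph V) (k : ℕ) :
    ∑ v, rootedUrsell G k v = PowerSeries.coeff k (logDerivative (chromaticSeries G)) := by
  simp only [rootedUrsell, Finset.sum_filter]
  rw [Finset.sum_comm, ← sum_ursell]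
  refine Finset.sum_congr rfl fun U _ => ?_
  rw [← Finset.sum_filter, Finset.sum_const, Finset.filter_univ_mem, nsmul_eq_mul]
  -- The empty set has no element to carry its share, so its contribution must be zero.
  rcases U.eq_empty_or_nonempty with rfl | hU
  · simp [ursell_empty]
  · have : (U.card : ℚ) ≠ 0 := by exact_mod_cast hU.card_pos.ne'
    field_simp

/-- Locality: only the contributing sets around `f v` matter, and here they all lie in the image of
`f`. -/
theorem rootedUrsell_map [DecidableEq V] [DecidableEq W] {G : SimpleGraph V} {H : SimpleGraph W}
    (f : G ↪g H) (k : ℕ) (v : V)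
    (hf : ∀ U : Finset W, f v ∈ U → ursell H k U ≠ 0 → ∀ w ∈ U, w ∈ Set.range f) :
    rootedUrsell H k (f v) = rootedUrsell G k v := by
  unfold rootedUrsell
  symm
  refine Finset.sum_bij_ne_zero (fun U _ _ => U.map f.toEmbedding) ?_ ?_ ?_ ?_
  · intro U hU _
    simpa using hU
  · intro U _ _ U' _ _ h
    exact Finset.map_injective _ h
  · intro T hT hne
    have hT' := (Finset.mem_filter.1 hT).2
    have hne' : ursell H k T ≠ 0 := fun h => hne (by rw [h, zero_div])
    obtain ⟨U, -, rfl⟩ : ∃ U ⊆ (Finset.univ : Finset V), T = U.map f.toEmbedding := by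
      refine Finset.subset_map_iff.1 fun w hw => ?_
      obtain ⟨x, rfl⟩ := hf T hT' hne' w hw
      simp
    refine ⟨U, by simpa using hT', ?_, rfl⟩
    rwa [ursell_map, Finset.card_map] at hne
  · intro U _ _
    rw [ursell_map, Finset.card_map]

end Series
/-! ### Toroidal grids -/

section Torus

/-- An embedding of graphs induces an embedding of their box powers. -/
def boxPowMap {V W : Type*} {G : SimpleGraph V} {H : SimpleGraph W} (f : G ↪g H) (d : ℕ) :
    boxPow G d ↪g boxPow H d where
  toFun x i := f (x i)
  inj' x y h := funext fun i => f.injective (congrFun h i)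
  map_rel_iff' := by
    intro x y
    change (∃ i, H.Adj (f (x i)) (f (y i)) ∧ ∀ j, j ≠ i → f (x j) = f (y j)) ↔
      ∃ i, G.Adj (x i) (y i) ∧ ∀ j, j ≠ i → x j = y j
    simp only [f.map_adj_iff, f.injective.eq_iff]

theorem val_sub_eq {n : ℕ} (u v : Fin n) :
    ((u - v : Fin n) : ℕ) = if v ≤ u then (u : ℕ) - v else n + u - v := by
  split_ifs with h
  · exact Fin.sub_val_of_le h
  · exact Fin.coe_sub_iff_lt.2 (not_le.1 h)

theorem cycleGraph_adj_iff_val {n : ℕ} {u v : Fin n} :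
    (SimpleGraph.cycleGraph n).Adj u v ↔ (u : ℕ) = v + 1 ∨ (v : ℕ) = u + 1 ∨
      ((u : ℕ) + n = v + 1 ∧ u ≠ v) ∨ ((v : ℕ) + n = u + 1 ∧ u ≠ v) := by
  rw [SimpleGraph.cycleGraph_adj', val_sub_eq, val_sub_eq]
  have := u.2
  have := v.2
  simp only [ne_eq, Fin.ext_iff, Fin.le_def]
  split_ifs <;> omega

/-- A path is an induced subgraph of every longer cycle. -/
def pathEmbedding {m n : ℕ} (h : m < n) : SimpleGraph.pathGraph m ↪g SimpleGraph.cycleGraph n where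
  toFun := Fin.castLE h.le
  inj' := Fin.castLE_injective h.le
  map_rel_iff' := by
    intro u v
    have := u.2
    have := v.2
    simp only [Function.Embedding.coeFn_mk, cycleGraph_adj_iff_val, SimpleGraph.pathGraph_adj,
      Fin.val_castLE]
    omega

/-- The translations of the toroidal grid. -/
def translation (d n : ℕ) [NeZero n] (t : Fin d → Fin n) : torusGraph d n ↪g torusGraph d n where
  toFun x := x + t
  inj' := add_left_injective t
  map_rel_iff' := by
    intro x y
    simp [torusGraph, boxPow, SimpleGraph.cycleGraph_adj', add_sub_add_right_eq_sub]

theorem rootedUrsell_torusGraph_eq (d n k : ℕ) (x y : Fin d → Fin n) :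
    rootedUrsell (torusGraph d n) k x = rootedUrsell (torusGraph d n) k y := by
  rcases Nat.eq_zero_or_pos n with rfl | hn
  · rw [show x = y from funext fun i => (x i).elim0]
  · have : NeZero n := ⟨hn.ne'⟩
    rw [← rootedUrsell_map (translation d n (y - x)) k x fun U _ _ w _ =>
      ⟨w - (y - x), sub_add_cancel w (y - x)⟩]
    congr 1
    exact add_sub_cancel x y

/-- A walk does not leave a box that is large compared to its length. -/
theorem val_le_of_walk {d n r : ℕ} (hn : 2 * r + 1 < n) {u w : Fin d → Fin n}
    (p : (torusGraph d n).Walk u w) (a : ℕ) (ha : a + p.length ≤ r)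
    (hu : ∀ i, (u i : ℕ) ≤ r + a ∧ r ≤ u i + a) (i : Fin d) : (w i : ℕ) < 2 * r + 1 := by
  induction p generalizing a with
  | nil => have := hu i; omega
  | cons h p ih =>
    rw [SimpleGraph.Walk.length_cons] at ha
    refine ih (a + 1) (by omega) fun j => ?_
    -- Here `a` bounds the distance of each coordinate from `r`. As `a < r`, a step cannot wrap
    -- around the cycle.
    obtain ⟨j₀, hj₀, hj⟩ := h
    have h1 := hu j
    by_cases hjj : j = j₀
    · subst hjj
      rw [cycleGraph_adj_iff_val] at hj₀
      omega
    · rw [← hj j hjj]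
      omega

/-- The contribution of a vertex of a large toroidal grid. -/
noncomputable def gridConstant (d k : ℕ) : ℚ :=
  rootedUrsell (boxPow (SimpleGraph.pathGraph (2 * (2 * (k + 1)) + 1)) d) k
    fun _ => ⟨2 * (k + 1), by omega⟩

theorem rootedUrsell_torusGraph {d n k : ℕ} (hn : 2 * (2 * (k + 1)) + 1 < n)
    (x : Fin d → Fin n) : rootedUrsell (torusGraph d n) k x = gridConstant d k := by
  set r := 2 * (k + 1) with hr
  let f : boxPow (SimpleGraph.pathGraph (2 * r + 1)) d ↪g torusGraph d n :=
    boxPowMap (pathEmbedding hn) d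
  let c : Fin d → Fin (2 * r + 1) := fun _ => ⟨r, by omega⟩
  rw [rootedUrsell_torusGraph_eq d n k x (f c)]
  refine rootedUrsell_map f k c fun U hU hne w hw => ?_
  -- A path inside `U` has fewer than `U.card ≤ r` edges, so it stays in the box of side `2 * r + 1`
  -- centred at its start.
  obtain ⟨p, hp⟩ := (reachable_of_ursell_ne_zero hne ⟨f c, hU⟩ ⟨w, hw⟩).exists_isPath
  have h1 := hp.length_lt
  have h2 : Fintype.card (U : Set (Fin d → Fin n)) = U.card := by simp
  have h3 := card_le_of_ursell_ne_zero hne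
  have h4 := val_le_of_walk hn
    (p.map (SimpleGraph.Embedding.induce (G := torusGraph d n) (U : Set _)).toHom) 0
    (by rw [SimpleGraph.Walk.length_map]; omega) fun i => ⟨le_rfl, le_rfl⟩
  exact ⟨fun i => ⟨w i, h4 i⟩, rfl⟩

theorem coeff_logDerivative_torusGraph {d n k : ℕ} (hn : 2 * (2 * (k + 1)) + 1 < n) :
    PowerSeries.coeff k (logDerivative (chromaticSeries (torusGraph d n))) =
      (n : ℚ) ^ d * gridConstant d k := by
  rw [← sum_rootedUrsell, Finset.sum_congr rfl fun x _ => rootedUrsell_torusGraph hn x]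
  simp

end Torus

/-! ### Sequences of binomial type from logarithmic derivatives -/

section Binomial

/-- The coefficients of the powers of the power series with a given logarithmic derivative and
constant coefficient `1`, as polynomials in the exponent. -/
noncomputable def powerPolynomial (c : ℕ → ℚ) : ℕ → ℚ[X]
  | 0 => 1
  | k + 1 => C (1 / ((k : ℚ) + 1)) * X * ∑ i : Fin (k + 1), C (c i) * powerPolynomial c (k - i)

theorem powerPolynomial_succ_eval (c : ℕ → ℚ) (k : ℕ) (y : ℚ) :
    (powerPolynomial c (k + 1)).eval y * (k + 1) =
      ∑ i ∈ Finset.range (k + 1), y * c i * (powerPolynomial c (k - i)).eval y := by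
  have h : (k : ℚ) + 1 ≠ 0 := by positivity
  rw [powerPolynomial, Fin.sum_univ_eq_sum_range (fun i => C (c i) * powerPolynomial c (k - i))]
  simp only [eval_mul, eval_C, eval_X, eval_finsetSum, Finset.mul_sum, Finset.sum_mul]
  refine Finset.sum_congr rfl fun i _ => ?_
  field_simp

/-- The cutoff `K` is essential: for a given torus size the logarithmic derivative is known only in
low orders. -/
theorem eq_powerPolynomial_eval {c z : ℕ → ℚ} {y : ℚ} (h0 : z 0 = 1) {K : ℕ}
    (h : ∀ k < K, z (k + 1) * (k + 1) = ∑ i ∈ Finset.range (k + 1), y * c i * z (k - i)) :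
    ∀ k ≤ K, z k = (powerPolynomial c k).eval y := by
  intro k
  induction k using Nat.strong_induction_on with
  | _ k ih =>
    intro hk
    cases k with
    | zero => simp [h0, powerPolynomial]
    | succ k =>
      have hne : (k : ℚ) + 1 ≠ 0 := by positivity
      apply mul_right_cancel₀ hne
      rw [h k hk, powerPolynomial_succ_eval]
      exact Finset.sum_congr rfl fun i _ => by rw [ih (k - i) (by omega) (by omega)]

/-- The series `F` at exponent `1` solves `F' = c * F`, so `F ^ n` has logarithmic derivative `n *
c` and obeys the recursion at `y = n`. -/
theorem isBinomialType_powerPolynomial (c : ℕ → ℚ) : IsBinomialType (powerPolynomial c) where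
  zero := by rw [powerPolynomial]
  eval_zero i hi := by
    obtain ⟨k, rfl⟩ := Nat.exists_eq_succ_of_ne_zero hi.ne'
    simp [powerPolynomial]
  pow_eq n := by
    set F : PowerSeries ℚ := PowerSeries.mk fun i => (powerPolynomial c i).eval 1 with hF
    have hF' : PowerSeries.derivative ℚ F = PowerSeries.mk c * F := by
      ext k
      rw [PowerSeries.coeff_derivative, PowerSeries.coeff_mul,
        Finset.Nat.sum_antidiagonal_eq_sum_range_succ_mk]
      simp [hF, powerPolynomial_succ_eval]
    have hFn : PowerSeries.derivative ℚ (F ^ n) =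
        PowerSeries.C (n : ℚ) * PowerSeries.mk c * F ^ n := by
      rw [Derivation.leibniz_pow, hF']
      cases n with
      | zero => simp
      | succ n =>
        rw [Nat.add_sub_cancel, smul_eq_mul, nsmul_eq_mul, map_natCast]
        ring
    ext k
    rw [PowerSeries.coeff_mk]
    refine eq_powerPolynomial_eval (c := c) (z := fun k => PowerSeries.coeff k (F ^ n)) ?_ (K := k)
      (fun k _ => ?_) k le_rfl
    · simp [hF, powerPolynomial]
    · rw [← PowerSeries.coeff_derivative, hFn, PowerSeries.coeff_mul,
        Finset.Nat.sum_antidiagonal_eq_sum_range_succ_mk]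
      simp only [PowerSeries.coeff_C_mul, PowerSeries.coeff_mk]

end Binomial

end ToroidalGrid

theorem mainTheorem1 (d : ℕ) (hd : 1 ≤ d) :
    ∃ p : ℕ → ℚ[X], ToroidalGrid.IsBinomialType p ∧
      ∀ k : ℕ, ∀ᶠ n : ℕ in atTop,
        (-1 : ℚ) ^ k *
            ((ToroidalGrid.chromaticPolynomial (ToroidalGrid.torusGraph d n)).coeff
              (n ^ d - k) : ℚ) =
          (p k).eval ((n : ℚ) ^ d) := by
  refine ⟨_, ToroidalGrid.isBinomialType_powerPolynomial (ToroidalGrid.gridConstant d),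
    fun k => ?_⟩
  filter_upwards [eventually_gt_atTop (2 * (2 * (k + 1)) + 1)] with n hn
  have hZ : PowerSeries.constantCoeff
      (ToroidalGrid.chromaticSeries (ToroidalGrid.torusGraph d n)) = 1 := by
    rw [← ToroidalGrid.within_univ (ToroidalGrid.torusGraph d n),
      ToroidalGrid.constantCoeff_chromaticSeries_within]
  -- This makes `n ^ d - k` a genuine subtraction, in agreement with `revAt`; it uses `d ≠ 0`.
  have hk : k ≤ n ^ d := by
    have := Nat.le_self_pow (by omega : d ≠ 0) n
    omega
  rw [← ToroidalGrid.eq_powerPolynomial_eval (z := fun j => PowerSeries.coeff j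
    (ToroidalGrid.chromaticSeries (ToroidalGrid.torusGraph d n))) (K := k) ?_ (fun j hj => ?_) k
    le_rfl]
  · rw [ToroidalGrid.coeff_chromaticSeries, revAt_le (by simpa using hk)]
    simp
  · simpa using hZ
  · rw [ToroidalGrid.coeff_succ_eq_sum_logDerivative (by rw [hZ]; exact one_ne_zero)]
    refine Finset.sum_congr rfl fun i hi => ?_
    rw [Finset.mem_range] at hi
    rw [ToroidalGrid.coeff_logDerivative_torusGraph (by omega)]
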